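/- Let $D\subseteq\mathbb R^d$ be a centered symmetric convex body, i.e. a compact convex set with $0\in\operatorname{int}D$ and $D=-D$. Let $D^\circ=\{z\in\mathbb R^d : x\cdot z\le 1\ \text{for all } x\in D\}$ be its polar set and $|x|_{D^\circ}=\inf\{a>0: x\in aD^\circ\}$ the norm it induces. For $\Omega\subseteq\mathbb R^d$ let $$\delta_{D^\circ}(\Omega)=\sup_{z\in\mathbb R^d}\inf_{\omega\in\Omega}|\omega-z|_{D^\circ}\in[0,\infty]$$ be its gap, and for $\omega\in\Omega$ let $\mu_\omega$ be the Voronoi weight of $\omega$ for this norm, i.e. the Lebesgue measure of $\{z\in\mathbb R^d: |\omega-z|_{D^\circ}\le|\lambda-z|_{D^\circ}\ \text{for all }\lambda\in\Omega\setminus\{\omega\}\}$. Let $L^2(D)$ be the space of complex-valued functions in $L^2(\mathbb R^d)$ supported on $D$, with the $L^2$-norm $\|\cdot\|$; put $\hat f(\xi)=\int_{\mathbb R^d} f(x)e^{-2\pi i\xi\cdot x}\,dx$, and let $B_K=\{\xi\in\mathbb R^d:|\xi|\le K\}$ be the Euclidean ball. A sequence $(\mathcal R_N)_{N\ge1}$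 of linear subspaces of $L^2(D)$ has *residual decay of order* $\alpha>0$ if for every $\theta>0$ there is a constant $c_\theta>0$ such that $$\sup_{N\ge1}\ \sup_{f\in\mathcal R_N,\ \|f\|=1}\ \int_{|\xi|>c_\theta N^\alpha}|\hat f(\xi)|^2\,d\xi\le\theta .$$ Let $\varepsilon>0$. There is a constant $A>0$, depending only on $\varepsilon$ and $D$, such that the following holds. Let $(\mathcal R_N)_{N\ge1}$ be a sequence of subspaces of $L^2(D)$ with residual decay of some order $\alpha>0$, with constants $(c_\theta)_{\theta>0}$. Then there is a constant $c>0$, depending only on $\varepsilon$, $D$ and $(c_\theta)_{\theta>0}$ (and in particular not on $\Omega$), such that for every closed countable set $\Omega\subseteq\mathbb R^d$ with $\delta_{D^\circ}(\Omega)\le\tfrac14(1-\varepsilon)$, $$A\|f\|^2\le\sum_{\omega\in\Omega\cap B_{cN^\alpha}}\mu_\omega|\hat f(\omega)|^2\qquad\text{for all } f\in\mathcal R_N \text{ and all } N\ge1 .$$ -/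

import Mathlib

open MeasureTheory Set
open scoped ENNReal FourierTransform

noncomputable section

/-- `ℝ^d` with the Euclidean norm; it also serves as the frequency domain. -/
abbrev Rd (d : ℕ) : Type := EuclideanSpace ℝ (Fin d)

/-- `D` is a centered symmetric convex body: compact, convex, `0 ∈ int D` and `D = -D`. -/
structure IsCenteredSymmetricConvexBody {d : ℕ} (D : Set (Rd d)) : Prop where
  convex : Convex ℝ D
  isCompact : IsCompact D
  zero_mem_interior : (0 : Rd d) ∈ interior D
  symmetric : ∀ x ∈ D, -x ∈ D

/-- The polar set `D° = {z : x · z ≤ 1 for all x ∈ D}`. -/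
def polarSet {d : ℕ} (D : Set (Rd d)) : Set (Rd d) :=
  {z | ∀ x ∈ D, inner ℝ x z ≤ 1}

/-- The gap `δ_B(Ω) = sup_z inf_{ω ∈ Ω} |ω - z|_B`, where
`|x|_B = gauge B x = inf {a > 0 : x ∈ a B}`. It is extended-real valued, so that the gap of the
empty set is `+∞`, as is that of a set which leaves arbitrarily large holes. -/
def gap {d : ℕ} (B Ω : Set (Rd d)) : EReal :=
  ⨆ z : Rd d, ⨅ ω ∈ Ω, ((gauge B (ω - z) : ℝ) : EReal)

/-- The Voronoi region of `ω` relative to `Ω` and the norm `|·|_B`. -/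
def voronoiRegion {d : ℕ} (B Ω : Set (Rd d)) (ω : Rd d) : Set (Rd d) :=
  {z | ∀ l ∈ Ω, l ≠ ω → gauge B (ω - z) ≤ gauge B (l - z)}

/-- The Voronoi weight `μ_ω`: the Lebesgue measure of the Voronoi region. -/
def voronoiWeight {d : ℕ} (B Ω : Set (Rd d)) (ω : Rd d) : ℝ≥0∞ :=
  volume (voronoiRegion B Ω ω)

/-- `L²(D)`, as the subspace of `L²(ℝ^d)` (complex valued) of the functions supported on `D`. -/
def L2On {d : ℕ} (D : Set (Rd d)) : Submodule ℂ (Lp ℂ 2 (volume : Measure (Rd d))) where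
  carrier := {f | ∀ᵐ x ∂(volume : Measure (Rd d)), x ∉ D → f x = 0}
  zero_mem' := by
    filter_upwards [Lp.coeFn_zero ℂ 2 (volume : Measure (Rd d))] with x hx _ using hx
  add_mem' := by
    intro f g hf hg
    rw [mem_ofPred_eq] at hf hg
    show ∀ᵐ x ∂(volume : Measure (Rd d)), x ∉ D → ((f + g : Lp ℂ 2 (volume : Measure (Rd d)))) x = 0
    filter_upwards [Lp.coeFn_add f g, hf, hg] with x hx h1 h2 hD
    rw [hx, Pi.add_apply, h1 hD, h2 hD, add_zero]
  smul_mem' := by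
    intro a f hf
    rw [mem_ofPred_eq] at hf
    show ∀ᵐ x ∂(volume : Measure (Rd d)), x ∉ D → ((a • f : Lp ℂ 2 (volume : Measure (Rd d)))) x = 0
    filter_upwards [Lp.coeFn_smul a f, hf] with x hx h1 hD
    rw [hx, Pi.smul_apply, h1 hD, smul_zero]

/-- The Fourier transform `f̂(ξ) = ∫ f(x) e^{-2πi ξ·x} dx`, as an honest integral at each point `ξ`.
It is used only for square integrable `f` supported on a compact set; these are integrable. -/
def fhat {d : ℕ} (f : Lp ℂ 2 (volume : Measure (Rd d))) (ξ : Rd d) : ℂ :=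
  𝓕 (fun x : Rd d => f x) ξ

/-- The residual `V_*(R, K) = sup {∫_{|ξ| > K} |f̂(ξ)|² dξ : f ∈ R, ‖f‖ = 1}`. -/
def fourierResidual {d : ℕ} (R : Submodule ℂ (Lp ℂ 2 (volume : Measure (Rd d)))) (K : ℝ) : ℝ≥0∞ :=
  ⨆ f ∈ R, ⨆ _ : ‖f‖ = 1, ∫⁻ ξ in {ξ : Rd d | K < ‖ξ‖}, ‖fhat f ξ‖ₑ ^ 2

/-- The sequence `(R_N)_{N ≥ 1}` has residual decay of order `α` with constants `θ ↦ κ θ`: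
for every `θ > 0` one has `κ θ > 0` and `sup_{N ≥ 1} V_*(R_N, κ θ * N^α) ≤ θ`.
Having residual decay of order `α` means that such a `κ` exists. -/
def HasResidualDecayWith {d : ℕ} (R : ℕ → Submodule ℂ (Lp ℂ 2 (volume : Measure (Rd d))))
    (α : ℝ) (κ : ℝ → ℝ) : Prop :=
  ∀ θ : ℝ, 0 < θ →
    0 < κ θ ∧ ⨆ (N : ℕ) (_ : 1 ≤ N), fourierResidual (R N) (κ θ * (N : ℝ) ^ α) ≤ ENNReal.ofReal θ

end

/-! Write F = `fhat f` and h = `𝓕 ψ`, with ψ a bump supported in κD and h(0) = 1. For fixed x₀ the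
function F · h(· - x₀) is continuous and vanishes at infinity, so its modulus peaks at some y₀,
where it is at least |F(x₀)|. Its spectrum lies in (1 + κ)D. A band-limited function on a line falls
off from a maximum of its modulus no faster than a cosine (`cos_mul_norm_le_of_norm_le`), so the
product is still at least a fixed multiple of |F(x₀)| at every point whose polar distance to y₀ is a
little over (1 - ε)/4; the bound 1/4 keeps the cosine positive.

Let s be a nearest-point map into Ω. For every z in a small ball about y₀, s z is such a point.
Integrating over that ball gives |F(x₀)|² ≲ ∫ |F(s z)|² |h(s z - x₀)|² dz
(`enorm_fhat_sq_le_lintegral`), in which y₀ no longer appears.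

Integrating over |x₀| ≤ K, samples with |s z| > K + L contribute only through the tail of h. That
contribution is absorbed by the Plancherel–Pólya bound ∫ |F(s z)|² ≲ ‖f‖², itself the same pointwise
inequality with s the identity. Residual decay places three quarters of ‖f‖² in the ball of radius
K. Finally the fibres of s lie in Voronoi regions, which turns the integral into the weighted sum.
-/

noncomputable section

/-! ### One-dimensional cosine comparison at a maximum -/

open Complex in
theorem fourierCoeffOn_exp_sub_linear {t : ℝ} (ht : |t| < 1) {n : ℤ} (hn : n ≠ 0)
    (hab : -Real.pi < -Real.pi + 2 * Real.pi) :
    fourierCoeffOn hab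
        (fun l : ℝ => exp (l * t * I) - l * (Real.sin (Real.pi * t) / Real.pi) * I) n =
      ((-1 : ℝ) ^ n * (t * Real.sin (Real.pi * t) / (Real.pi * (n * (t - n)))) : ℝ) := by
  have htn : (t : ℂ) - n ≠ 0 := by
    intro h
    have h1 : t = n := by exact_mod_cast sub_eq_zero.mp h
    rw [h1] at ht
    have h2 : |n| < 1 := by exact_mod_cast ht
    exact hn (Int.abs_lt_one_iff.mp h2)
  have hnC : (n : ℂ) ≠ 0 := by exact_mod_cast hn
  have hpi : (Real.pi : ℂ) ≠ 0 := by exact_mod_cast Real.pi_ne_zero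
  set S : ℂ := Real.sin (Real.pi * t) / Real.pi with hS
  have hderiv : ∀ x ∈ uIcc (-Real.pi) (-Real.pi + 2 * Real.pi),
      HasDerivAt (fun l : ℝ => exp (l * t * I) - l * S * I)
        (exp (x * t * I) * (t * I) - S * I) x := by
    intro x _
    have h0 : HasDerivAt (fun l : ℝ => (l : ℂ)) 1 x := Complex.ofRealCLM.hasDerivAt
    have h1 : HasDerivAt (fun l : ℝ => (l : ℂ) * t * I) (t * I) x := by
      simpa using (h0.mul_const (t : ℂ)).mul_const I
    have h2 : HasDerivAt (fun l : ℝ => (l : ℂ) * S * I) (S * I) x := by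
      simpa using (h0.mul_const S).mul_const I
    exact h1.cexp.sub h2
  have hexp (a : ℂ) (ha : a ≠ 0) : ∫ l : ℝ in (-Real.pi)..Real.pi, exp (a * l)
      = (exp (a * Real.pi) - exp (a * (-Real.pi : ℝ))) / a := integral_exp_mul_complex ha
  have hs : Real.sin (Real.pi * t) = (exp (Real.pi * t * I) - exp (-(Real.pi * t * I))) * (-I) / 2 := by
    rw [Complex.ofReal_sin, Complex.sin]; push_cast; ring_nf
  have hen : exp (-(n * Real.pi * I)) = (-1) ^ n := by
    have : -(n * Real.pi * I) = ((-n : ℤ) : ℂ) * (Real.pi * I) := by push_cast; ring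
    rw [this, Complex.exp_int_mul, Complex.exp_pi_mul_I, zpow_neg, ← inv_zpow]; norm_num
  have hen' : exp (n * Real.pi * I) = (-1) ^ n := by
    have : n * Real.pi * I = (n : ℂ) * (Real.pi * I) := by ring
    rw [this, Complex.exp_int_mul, Complex.exp_pi_mul_I]
  rw [fourierCoeffOn_of_hasDerivAt hab hn hderiv
    (Continuous.intervalIntegrable (by fun_prop) _ _), fourierCoeffOn_eq_integral]
  -- The slope `S` is the one for which subtracting the linear term equalises the values at -π and
  -- π, so the boundary term of the integration by parts vanishes.
  have hbd : (exp ((-Real.pi + 2 * Real.pi : ℝ) * t * I) - (-Real.pi + 2 * Real.pi : ℝ) * S * I)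
      - (exp ((-Real.pi : ℝ) * t * I) - (-Real.pi : ℝ) * S * I) = 0 := by
    rw [hS, hs]
    have : -Real.pi + 2 * Real.pi = Real.pi := by ring
    rw [this]; push_cast
    have : -(Real.pi : ℂ) * t * I = -(Real.pi * t * I) := by ring
    rw [this]
    field_simp
    ring_nf
    simp [I_sq]
  rw [hbd]
  have hint : ∫ x : ℝ in (-Real.pi)..(-Real.pi + 2 * Real.pi),
      (fourier (-n)) (x : AddCircle (-Real.pi + 2 * Real.pi - -Real.pi)) •
        (exp (x * t * I) * (t * I) - S * I) =
      (t * I) * (2 * Real.sin (Real.pi * t) * (-1) ^ n / (t - n)) := by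
    have e1 : -Real.pi + 2 * Real.pi = Real.pi := by ring
    have : ∀ x : ℝ, (fourier (-n)) (x : AddCircle (-Real.pi + 2 * Real.pi - -Real.pi)) •
        (exp (x * t * I) * (t * I) - S * I)
        = (t * I) * exp (((t - n) * I) * x) - (S * I) * exp ((-(n : ℂ) * I) * x) := by
      intro x
      rw [fourier_coe_apply, smul_eq_mul, mul_sub, ← mul_assoc, ← Complex.exp_add]
      have e2 : 2 * Real.pi * I * ((-n : ℤ) : ℂ) * x /
          ((-Real.pi + 2 * Real.pi - -Real.pi : ℝ) : ℂ) = -(n : ℂ) * I * x := by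
        push_cast; field_simp; ring
      rw [e2]
      ring_nf
    simp_rw [this]
    rw [intervalIntegral.integral_sub (Continuous.intervalIntegrable (by fun_prop) _ _)
      (Continuous.intervalIntegrable (by fun_prop) _ _),
      intervalIntegral.integral_const_mul, intervalIntegral.integral_const_mul, e1,
      hexp _ (mul_ne_zero htn I_ne_zero), hexp _ (mul_ne_zero (neg_ne_zero.mpr hnC) I_ne_zero)]
    have a1 : (t - n) * I * Real.pi = Real.pi * t * I + -(n * Real.pi * I) := by ring
    have a2 : (t - n) * I * (-Real.pi : ℝ) = -(Real.pi * t * I) + n * Real.pi * I := by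
      push_cast; ring
    have a3 : -(n : ℂ) * I * Real.pi = -(n * Real.pi * I) := by ring
    have a4 : -(n : ℂ) * I * (-Real.pi : ℝ) = n * Real.pi * I := by push_cast; ring
    rw [a1, a2, a3, a4, Complex.exp_add, Complex.exp_add, hen, hen', hs]
    field_simp
    ring_nf
    simp [I_sq]
    ring
  rw [hint]
  push_cast
  rw [real_smul]
  push_cast
  field_simp
  ring

open Complex in
/-- A Lagrange-type interpolation of `exp (i λ t)` at the integers, on `|λ| ≤ π`, with alternating
coefficients. -/
theorem exists_alternating_interpolation {t : ℝ} (ht : |t| < 1) (ht0 : t ≠ 0) :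
    ∃ c : ℤ → ℝ, Summable c ∧ (∀ n, n ≠ 0 → (-1 : ℝ) ^ n * c n ≤ 0) ∧
      ∀ l : ℝ, |l| ≤ Real.pi → HasSum (fun n : ℤ => (c n : ℂ) * exp (l * n * I))
        (exp (l * t * I) - l * (Real.sin (Real.pi * t) / Real.pi) * I) := by
  have hT : Fact (0 < 2 * Real.pi) := ⟨Real.two_pi_pos⟩
  have hab : -Real.pi < -Real.pi + 2 * Real.pi := lt_add_of_pos_right _ hT.out
  set f : ℝ → ℂ := fun l => exp (l * t * I) - l * (Real.sin (Real.pi * t) / Real.pi) * I with hf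
  have hpi : (Real.pi : ℂ) ≠ 0 := by exact_mod_cast Real.pi_ne_zero
  have e1 : -Real.pi + 2 * Real.pi = Real.pi := by ring
  have hs : Real.sin (Real.pi * t) = (exp (Real.pi * t * I) - exp (-(Real.pi * t * I))) * (-I) / 2 := by
    rw [Complex.ofReal_sin, Complex.sin]; push_cast; ring_nf
  have hfe : f (-Real.pi) = f (-Real.pi + 2 * Real.pi) := by
    rw [e1]
    simp only [hf]
    rw [hs]
    push_cast
    have : -(Real.pi : ℂ) * t * I = -(Real.pi * t * I) := by ring
    rw [this]
    field_simp
    ring_nf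
    simp [I_sq]
    ring
  have hfc : Continuous f := by fun_prop
  let G : C(AddCircle (2 * Real.pi), ℂ) :=
    ⟨AddCircle.liftIco (2 * Real.pi) (-Real.pi) f,
      AddCircle.liftIco_continuous hfe hfc.continuousOn⟩
  have hG (l : ℝ) (hl : |l| ≤ Real.pi) : G (l : AddCircle (2 * Real.pi)) = f l := by
    rw [abs_le] at hl
    rcases hl.2.eq_or_lt with h | h
    · have : ((Real.pi : ℝ) : AddCircle (2 * Real.pi)) = ((-Real.pi : ℝ) : AddCircle _) := by
        rw [← AddCircle.coe_add_period (2 * Real.pi) (-Real.pi), e1]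
      rw [h, this]
      show AddCircle.liftIco _ _ f _ = _
      rw [AddCircle.liftIco_coe_apply ⟨le_rfl, hab⟩, hfe, e1]
    · show AddCircle.liftIco _ _ f _ = _
      exact AddCircle.liftIco_coe_apply ⟨hl.1, by rw [e1]; exact h⟩
  have hcoef (n : ℤ) : fourierCoeff G n = fourierCoeffOn hab f n := fourierCoeff_liftIco_eq f n
  set c : ℤ → ℝ := fun n => (-1 : ℝ) ^ n * (t * Real.sin (Real.pi * t) / (Real.pi * (n * (t - n))))
    with hc
  have hcn (n : ℤ) (hn : n ≠ 0) : fourierCoeff G n = (c n : ℂ) := by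
    rw [hcoef, fourierCoeffOn_exp_sub_linear ht hn]
  have h0 : fourierCoeff G 0 = (Real.sin (Real.pi * t) / (Real.pi * t) : ℝ) := by
    rw [hcoef, fourierCoeffOn_eq_integral]
    have htI : (t : ℂ) * I ≠ 0 := mul_ne_zero (by exact_mod_cast ht0) I_ne_zero
    have h1 : ∫ x : ℝ in (-Real.pi)..(-Real.pi + 2 * Real.pi),
      (fourier (-0)) (x : AddCircle (-Real.pi + 2 * Real.pi - -Real.pi)) • f x =
        2 * Real.sin (Real.pi * t) / t := by
      have : ∀ x : ℝ, (fourier (-0)) (x : AddCircle (-Real.pi + 2 * Real.pi - -Real.pi)) • f x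
          = exp ((t * I) * x) - ((Real.sin (Real.pi * t) / Real.pi) * I) * (x : ℂ) := by
        intro x
        simp only [neg_zero, fourier_zero, one_smul, hf]
        ring_nf
      simp_rw [this]
      rw [intervalIntegral.integral_sub (Continuous.intervalIntegrable (by fun_prop) _ _)
        (Continuous.intervalIntegrable (by fun_prop) _ _), intervalIntegral.integral_const_mul,
        integral_exp_mul_complex htI, intervalIntegral.integral_ofReal, integral_id, e1, hs]
      have a1 : t * I * Real.pi = Real.pi * t * I := by ring
      have a2 : t * I * (-Real.pi : ℝ) = -(Real.pi * t * I) := by push_cast; ring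
      rw [a1, a2]
      push_cast
      have : (t : ℂ) ≠ 0 := by exact_mod_cast ht0
      field_simp
      ring_nf
      simp [I_sq]
      ring
    rw [h1, real_smul]
    push_cast
    have : (t : ℂ) ≠ 0 := by exact_mod_cast ht0
    field_simp
    ring
  -- The closed formula `c` degenerates to 0 at n = 0 through division by zero; the true mean value
  -- is put there instead.
  set b : ℤ → ℝ := fun n => if n = 0 then Real.sin (Real.pi * t) / (Real.pi * t) else c n with hb
  have hbG (n : ℤ) : fourierCoeff G n = (b n : ℂ) := by
    by_cases h : n = 0
    · subst h; simp only [hb, if_true]; exact h0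
    · simp only [hb, if_neg h]; exact hcn n h
  have hsum : Summable b := by
    -- Since |t| < 1, |n (t - n)| ≥ n² (1 - |t|), so the coefficients are O(1/n²).
    have hc' : Summable c := by
      have h2 : Summable fun n : ℤ => (|t * Real.sin (Real.pi * t)| / (Real.pi * (1 - |t|))) *
          (1 / (n : ℝ) ^ 2) :=
        (Real.summable_one_div_int_pow.mpr one_lt_two).mul_left _
      refine Summable.of_norm_bounded h2 fun n => ?_
      by_cases hn : n = 0
      · subst hn; simp [hc]
      have hn1 : (1 : ℝ) ≤ |(n : ℝ)| := by exact_mod_cast Int.one_le_abs hn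
      have h1t : 0 < 1 - |t| := by linarith
      have hlow : |(n : ℝ)| * (1 - |t|) ≤ |t - n| := by
        have := abs_sub_abs_le_abs_sub (n : ℝ) t
        rw [abs_sub_comm] at this
        nlinarith [abs_nonneg t]
      simp only [hc, norm_mul, norm_div, norm_zpow, norm_neg, norm_one, one_zpow, one_mul,
        Real.norm_eq_abs, abs_of_pos Real.pi_pos, abs_mul]
      have hp := Real.pi_pos
      rw [div_mul_div_comm, mul_one, ← sq_abs (n : ℝ), mul_assoc]
      refine div_le_div_of_nonneg_left (by positivity) (by positivity) ?_
      exact mul_le_mul_of_nonneg_left (by nlinarith) hp.le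
    refine hc'.congr_cofinite ?_
    filter_upwards [(Set.finite_singleton (0 : ℤ)).compl_mem_cofinite] with n hn
    have hn' : n ≠ 0 := by simpa using hn
    simp [hb, hn']
  refine ⟨b, hsum, ?_, ?_⟩
  · intro n hn
    simp only [hb, if_neg hn, hc]
    have h1 : (-1 : ℝ) ^ n * (-1 : ℝ) ^ n = 1 := by rw [← mul_zpow]; norm_num
    rw [← mul_assoc, h1, one_mul]
    have hsin : 0 ≤ t * Real.sin (Real.pi * t) := by
      have hp := Real.pi_pos
      rw [abs_lt] at ht
      rcases le_total 0 t with h | h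
      · exact mul_nonneg h (Real.sin_nonneg_of_nonneg_of_le_pi (by positivity) (by nlinarith))
      · exact mul_nonneg_of_nonpos_of_nonpos h
          (Real.sin_nonpos_of_nonpos_of_neg_pi_le (by nlinarith) (by nlinarith))
    have hden : (n : ℝ) * (t - n) ≤ 0 := by
      rw [abs_lt] at ht
      rcases lt_or_gt_of_ne hn with h | h
      · have : (n : ℝ) ≤ -1 := by exact_mod_cast Int.le_sub_one_of_lt h
        nlinarith
      · have : (1 : ℝ) ≤ n := by exact_mod_cast h
        nlinarith
    exact div_nonpos_of_nonneg_of_nonpos hsin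
      (mul_nonpos_of_nonneg_of_nonpos Real.pi_pos.le hden)
  · intro l hl
    have hsG : Summable (fourierCoeff G) := by
      rw [funext hbG]
      exact hsum.map Complex.ofRealCLM Complex.ofRealCLM.continuous
    have := has_pointwise_sum_fourier_series_of_summable hsG (l : AddCircle (2 * Real.pi))
    rw [hG l hl] at this
    convert! this using 2 with n
    rw [hbG, smul_eq_mul, fourier_coe_apply]
    congr 2
    push_cast
    field_simp

open Complex in
/-- If `g t = ∫ Q exp (i θ t)` with `|θ| ≤ π` attains its maximum modulus at `0`, then
`|g t| ≥ cos (π t) |g 0|` for `|t| < 1`. -/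
theorem cos_mul_norm_le_of_norm_le {X : Type*} [MeasurableSpace X] {μ : Measure X}
    {Q : X → ℂ} (hQ : Integrable Q μ) {θ : X → ℝ} (hθ : Measurable θ)
    (hQθ : ∀ x, Q x ≠ 0 → |θ x| ≤ Real.pi)
    (hmax : ∀ t : ℝ, ‖∫ x, Q x * exp (θ x * t * I) ∂μ‖ ≤ ‖∫ x, Q x ∂μ‖) {t : ℝ} (ht : |t| < 1) :
    Real.cos (Real.pi * t) * ‖∫ x, Q x ∂μ‖ ≤ ‖∫ x, Q x * exp (θ x * t * I) ∂μ‖ := by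
  set g : ℝ → ℂ := fun t => ∫ x, Q x * exp (θ x * t * I) ∂μ with hg
  set g0 : ℂ := ∫ x, Q x ∂μ with hg0
  have hnorm (x : X) (s : ℝ) : ‖exp (θ x * s * I)‖ = 1 := by
    exact_mod_cast Complex.norm_exp_ofReal_mul_I (θ x * s)
  have hint (s : ℝ) : Integrable (fun x => Q x * exp (θ x * s * I)) μ := by
    refine hQ.mul_bdd (c := 1) ?_ (Filter.Eventually.of_forall fun x => (hnorm x s).le)
    exact (Measurable.aestronglyMeasurable (by fun_prop))
  have hintθ : Integrable (fun x => Q x * (θ x * I)) μ := by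
    refine (hQ.norm.const_mul Real.pi).mono'
      (hQ.1.mul (Measurable.aestronglyMeasurable (by fun_prop))) ?_
    refine Filter.Eventually.of_forall fun x => ?_
    by_cases h : Q x = 0
    · simp [h]
    · simp only [norm_mul, Complex.norm_I, mul_one, Complex.norm_real, Real.norm_eq_abs]
      rw [mul_comm]
      gcongr
      exact hQθ x h
  set m : ℂ := ∫ x, Q x * (θ x * I) ∂μ with hm
  -- `r` is the component of g along g(0), scaled by |g(0)|, and `l` is its derivative at 0.
  set r : ℝ → ℝ := fun s => (starRingEnd ℂ g0 * g s).re with hr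
  set l : ℝ := (starRingEnd ℂ g0 * m).re with hl
  have hrle (s : ℝ) : |r s| ≤ ‖g0‖ ^ 2 := by
    refine (Complex.abs_re_le_norm _).trans ?_
    rw [norm_mul, RCLike.norm_conj, sq]
    gcongr
    exact hmax s
  have key (s : ℝ) (hs : |s| < 1) (hs0 : s ≠ 0) :
      ‖g0‖ ^ 2 * Real.cos (Real.pi * s) ≤ r s - l * (Real.sin (Real.pi * s) / Real.pi) := by
    obtain ⟨c, hc, hsign, hexp⟩ := exists_alternating_interpolation hs hs0
    have hsumI : HasSum (fun n : ℤ => ∫ x, (c n : ℂ) * (Q x * exp (θ x * (n : ℝ) * I)) ∂μ)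
        (∫ x, ∑' n : ℤ, (c n : ℂ) * (Q x * exp (θ x * (n : ℝ) * I)) ∂μ) := by
      refine hasSum_integral_of_summable_integral_norm (fun n => (hint n).const_mul _) ?_
      simp only [norm_mul, hnorm, mul_one, Complex.norm_real]
      simp_rw [integral_const_mul]
      exact hc.norm.mul_right _
    have hts : (∫ x, ∑' n : ℤ, (c n : ℂ) * (Q x * exp (θ x * (n : ℝ) * I)) ∂μ)
        = g s - (Real.sin (Real.pi * s) / Real.pi : ℝ) * m := by
      rw [hg, hm, ← integral_const_mul, ← integral_sub (hint s) (hintθ.const_mul _)]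
      refine integral_congr_ae (Filter.Eventually.of_forall fun x => ?_)
      by_cases h : Q x = 0
      · simp [h]
      · have := (hexp (θ x) (hQθ x h)).mul_left (Q x)
        have h2 := this.tsum_eq
        simp only
        rw [show Q x * exp (θ x * s * I) - ((Real.sin (Real.pi * s) / Real.pi : ℝ) : ℂ) *
          (Q x * (θ x * I)) = Q x * (exp (θ x * s * I) -
            θ x * (Real.sin (Real.pi * s) / Real.pi) * I) by push_cast; ring, ← h2]
        congr 1 with n
        push_cast
        ring
    rw [hts] at hsumI
    have hre := Complex.hasSum_re (hsumI.mul_left (starRingEnd ℂ g0))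
    have e1 : (fun n : ℤ => (starRingEnd ℂ g0 *
        ∫ x, (c n : ℂ) * (Q x * exp (θ x * (n : ℝ) * I)) ∂μ).re) = fun n : ℤ => c n * r n := by
      funext n
      rw [integral_const_mul, hr, mul_left_comm, Complex.re_ofReal_mul]
    have e2 : (starRingEnd ℂ g0 * (g s - (Real.sin (Real.pi * s) / Real.pi : ℝ) * m)).re
        = r s - l * (Real.sin (Real.pi * s) / Real.pi) := by
      rw [mul_sub, Complex.sub_re, mul_left_comm, Complex.re_ofReal_mul, mul_comm l]
    rw [e1, e2] at hre
    -- At λ = π the real part of the interpolation identity is cos (πs) = Σ (-1)ⁿ c n: this is the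
    -- extremal case against which `r` is compared term by term.
    have hcos := hexp Real.pi (by rw [abs_of_pos Real.pi_pos])
    have hcos' : HasSum (fun n : ℤ => ‖g0‖ ^ 2 * (c n * (-1 : ℝ) ^ n))
        (‖g0‖ ^ 2 * Real.cos (Real.pi * s)) := by
      refine HasSum.mul_left _ ?_
      have h3 := Complex.hasSum_re hcos
      convert! h3 using 1
      · funext n
        rw [Complex.re_ofReal_mul]
        congr 1
        rw [show (Real.pi : ℂ) * n * I = (n : ℂ) * (Real.pi * I) by ring, Complex.exp_int_mul,
          Complex.exp_pi_mul_I]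
        have : ((-1 : ℂ)) ^ n = (((-1 : ℝ) ^ n : ℝ) : ℂ) := by push_cast; rfl
        rw [this, Complex.ofReal_re]
      · rw [Complex.sub_re, show (Real.pi : ℂ) * s * I = ((Real.pi * s : ℝ) : ℂ) * I by
          push_cast; ring, Complex.exp_ofReal_mul_I_re]
        rw [show (Real.pi : ℂ) * (Real.sin (Real.pi * s) / Real.pi) * I =
          ((Real.pi * (Real.sin (Real.pi * s) / Real.pi) : ℝ) : ℂ) * I by push_cast; ring,
          Complex.re_ofReal_mul, Complex.I_re, mul_zero, sub_zero]
    -- The n = 0 terms agree because r 0 = |g(0)|². For n ≠ 0, (-1)ⁿ c n ≤ 0 and |r n| ≤ |g(0)|²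
    -- give the inequality.
    refine hasSum_le (fun n => ?_) hcos' hre
    have hr0 : r 0 = ‖g0‖ ^ 2 := by
      have : g 0 = g0 := by simp [hg, hg0]
      simp only [hr, this]
      rw [mul_comm, Complex.mul_conj, Complex.ofReal_re, Complex.normSq_eq_norm_sq]
    by_cases hn : n = 0
    · subst hn; simp [hr0, mul_comm]
    · have h1 := hsign n hn
      have h2 := abs_le.mp (hrle n)
      rcases Int.even_or_odd n with h | h
      · rw [h.neg_one_zpow] at h1 ⊢
        nlinarith
      · rw [h.neg_one_zpow] at h1 ⊢
        nlinarith
  -- First-order condition at the maximum, read off from `key`: l sin (πs)/π ≤ |g(0)|² (1 - cos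
  -- (πs)). Dividing by sin (π|s|/2) and letting s → 0 from both sides forces l = 0.
  have hl0 : l = 0 := by
    have hlim (σ : ℝ) (hσ : |σ| = 1) : l * σ ≤ 0 := by
      have hbound : ∀ᶠ s : ℝ in nhdsWithin 0 (Ioi 0),
          l * σ * Real.cos (Real.pi * s / 2) ≤ Real.pi * ‖g0‖ ^ 2 * Real.sin (Real.pi * s / 2) := by
        filter_upwards [Ioo_mem_nhdsGT (zero_lt_one' ℝ)] with s hs
        have hσ2 : σ * σ = 1 := by rw [← abs_mul_abs_self, hσ, one_mul]
        have habs : |σ * s| < 1 := by rw [abs_mul, hσ, one_mul, abs_of_pos hs.1]; exact hs.2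
        have hne : σ * s ≠ 0 := mul_ne_zero (fun h => by simp [h] at hσ) hs.1.ne'
        have hk := key (σ * s) habs hne
        have hr' := (abs_le.mp (hrle (σ * s))).2
        have hcosσ : Real.cos (Real.pi * (σ * s)) = Real.cos (Real.pi * s) := by
          rcases eq_or_eq_neg_of_abs_eq hσ with h | h <;> rw [h]
          · simp
          · rw [show Real.pi * (-1 * s) = -(Real.pi * s) by ring, Real.cos_neg]
        have hsinσ : Real.sin (Real.pi * (σ * s)) = σ * Real.sin (Real.pi * s) := by
          rcases eq_or_eq_neg_of_abs_eq hσ with h | h <;> rw [h]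
          · simp
          · rw [show Real.pi * (-1 * s) = -(Real.pi * s) by ring, Real.sin_neg]; ring
        have hc2 : Real.cos (Real.pi * s) = 1 - 2 * Real.sin (Real.pi * s / 2) ^ 2 := by
          have := Real.cos_sq_add_sin_sq (Real.pi * s / 2)
          rw [show Real.pi * s = 2 * (Real.pi * s / 2) by ring, Real.cos_two_mul]
          rw [show 2 * (Real.pi * s / 2) / 2 = Real.pi * s / 2 by ring]
          linarith
        have hs2 : Real.sin (Real.pi * s) =
            2 * Real.sin (Real.pi * s / 2) * Real.cos (Real.pi * s / 2) := by
          rw [← Real.sin_two_mul]; congr 1; ring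
        have hpos : 0 < Real.sin (Real.pi * s / 2) :=
          Real.sin_pos_of_pos_of_lt_pi (by have := Real.pi_pos; have := hs.1; positivity)
            (by nlinarith [Real.pi_pos, hs.1, hs.2])
        rw [hcosσ, hsinσ, hc2, hs2] at hk
        have hk2 : l * (σ * (2 * Real.sin (Real.pi * s / 2) * Real.cos (Real.pi * s / 2)) / Real.pi)
            ≤ ‖g0‖ ^ 2 * (2 * Real.sin (Real.pi * s / 2) ^ 2) := by linarith
        rw [← mul_div_assoc, div_le_iff₀ Real.pi_pos] at hk2
        refine le_of_mul_le_mul_left ?_ (mul_pos two_pos hpos)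
        linarith
      have t1 : Filter.Tendsto (fun s : ℝ => l * σ * Real.cos (Real.pi * s / 2))
          (nhdsWithin 0 (Ioi 0)) (nhds (l * σ)) := by
        have : Continuous (fun s : ℝ => l * σ * Real.cos (Real.pi * s / 2)) := by fun_prop
        simpa using (this.tendsto 0).mono_left nhdsWithin_le_nhds
      have t2 : Filter.Tendsto (fun s : ℝ => Real.pi * ‖g0‖ ^ 2 * Real.sin (Real.pi * s / 2))
          (nhdsWithin 0 (Ioi 0)) (nhds 0) := by
        have : Continuous (fun s : ℝ => Real.pi * ‖g0‖ ^ 2 * Real.sin (Real.pi * s / 2)) := by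
          fun_prop
        simpa using (this.tendsto 0).mono_left nhdsWithin_le_nhds
      exact le_of_tendsto_of_tendsto t1 t2 hbound
    have h1 := hlim 1 (by simp)
    have h2 := hlim (-1) (by simp)
    linarith
  rcases eq_or_ne g0 0 with h0 | h0
  · simp [h0]
  have hpos : 0 < ‖g0‖ := norm_pos_iff.mpr h0
  by_cases ht0 : t = 0
  · subst ht0; simp [hg0]
  have hk := key t ht ht0
  rw [hl0, zero_mul, sub_zero] at hk
  have hrt : r t ≤ ‖g0‖ * ‖g t‖ := by
    refine (Complex.re_le_norm _).trans ?_
    rw [norm_mul, RCLike.norm_conj]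
  have : ‖g0‖ * (Real.cos (Real.pi * t) * ‖g0‖) ≤ ‖g0‖ * ‖g t‖ := by nlinarith
  exact le_of_mul_le_mul_left this hpos

/-! ### The pointwise Fourier transform on L²(D) and Plancherel -/

variable {d : ℕ}

open SchwartzMap

theorem L2On.integrable {D : Set (Rd d)} (hD : IsCompact D)
    {f : Lp ℂ 2 (volume : Measure (Rd d))} (hf : f ∈ L2On D) : Integrable (fun x => f x) := by
  have h1 : IntegrableOn (fun x => f x) D := by
    have : IsFiniteMeasure (volume.restrict D) := ⟨by simpa using hD.measure_lt_top⟩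
    exact ((Lp.memLp f).restrict D).integrable one_le_two
  have h2 : ∀ᵐ x, x ∉ D → f x = 0 := hf
  rw [← integrable_indicator_iff hD.measurableSet] at h1
  refine h1.congr ?_
  filter_upwards [h2] with x hx
  by_cases h : x ∈ D
  · simp [h]
  · simp [h, hx h]

theorem fhat_continuous {f : Lp ℂ 2 (volume : Measure (Rd d))}
    (hf : Integrable (fun x => f x)) : Continuous (fhat f) :=
  VectorFourier.fourierIntegral_continuous Real.continuous_fourierChar
    (by exact continuous_inner) hf

/-- Both sides define the same tempered distribution: against a smooth compactly supported function,
the transform can be moved onto the test function. -/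
theorem fhat_ae_eq_fourier {f : Lp ℂ 2 (volume : Measure (Rd d))}
    (hf : Integrable (fun x => f x)) :
    ∀ᵐ ξ, (𝓕 f : Lp ℂ 2 (volume : Measure (Rd d))) ξ = fhat f ξ := by
  refine ae_eq_of_integral_contDiff_smul_eq
    ((Lp.memLp _).locallyIntegrable one_le_two) (fhat_continuous hf).locallyIntegrable ?_
  intro g hg hgs
  let φ : 𝓢(Rd d, ℂ) := HasCompactSupport.toSchwartzMap (f := fun x => (g x : ℂ))
    (hgs.comp_left (g := fun y : ℝ => (y : ℂ)) rfl) (Complex.ofRealCLM.contDiff.comp hg)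
  have h1 := congrArg (fun T => T φ) (Lp.fourier_toTemperedDistribution_eq f)
  simp only [TemperedDistribution.fourier_apply, Lp.toTemperedDistribution_apply] at h1
  have h2 : ∫ x, g x • (𝓕 f : Lp ℂ 2 (volume : Measure (Rd d))) x
      = ∫ x, φ x • (𝓕 f : Lp ℂ 2 (volume : Measure (Rd d))) x := rfl
  rw [h2, ← h1]
  have h3 := VectorFourier.integral_fourierIntegral_smul_eq_flip (L := innerₗ (Rd d))
    (μ := volume) (ν := volume) (f := φ) (g := fun x => f x)
    Real.continuous_fourierChar (by exact continuous_inner) φ.integrable hf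
  rw [flip_innerₗ] at h3
  exact h3

theorem lintegral_enorm_fhat_sq {f : Lp ℂ 2 (volume : Measure (Rd d))}
    (hf : Integrable (fun x => f x)) :
    ∫⁻ ξ, ‖fhat f ξ‖ₑ ^ 2 = ENNReal.ofReal (‖f‖ ^ 2) := by
  have h1 : ∫⁻ ξ, ‖fhat f ξ‖ₑ ^ 2 =
      ∫⁻ ξ, ‖(𝓕 f : Lp ℂ 2 (volume : Measure (Rd d))) ξ‖ₑ ^ 2 := by
    refine lintegral_congr_ae ?_
    filter_upwards [fhat_ae_eq_fourier hf] with ξ h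
    rw [h]
  rw [h1, ← Lp.norm_fourier_eq f, ENNReal.ofReal_pow (norm_nonneg _), ofReal_norm,
    Lp.enorm_def, eLpNorm_eq_lintegral_rpow_enorm_toReal two_ne_zero ENNReal.ofNat_ne_top]
  simp only [ENNReal.toReal_ofNat, ENNReal.rpow_two, one_div]
  rw [← ENNReal.rpow_natCast, ← ENNReal.rpow_mul]
  simp

theorem fhat_smul (a : ℂ) (f : Lp ℂ 2 (volume : Measure (Rd d))) (ξ : Rd d) :
    fhat (a • f) ξ = a * fhat f ξ := by
  simp only [fhat, Real.fourier_eq]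
  rw [← integral_const_mul]
  refine integral_congr_ae ?_
  filter_upwards [Lp.coeFn_smul a f] with x hx
  rw [hx]
  simp [Circle.smul_def]
  ring

theorem lintegral_fhat_tail_le {R : Submodule ℂ (Lp ℂ 2 (volume : Measure (Rd d)))} {K θ : ℝ}
    (h : fourierResidual R K ≤ ENNReal.ofReal θ)
    {f : Lp ℂ 2 (volume : Measure (Rd d))} (hf : f ∈ R) :
    ∫⁻ ξ in {ξ : Rd d | K < ‖ξ‖}, ‖fhat f ξ‖ₑ ^ 2 ≤
      ENNReal.ofReal θ * ENNReal.ofReal (‖f‖ ^ 2) := by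
  by_cases h0 : f = 0
  · have : ∀ ξ, fhat f ξ = 0 := fun ξ => by
      have := fhat_smul 0 f ξ
      rwa [zero_smul, zero_mul, ← h0] at this
    simp [this]
  have hn : ‖f‖ ≠ 0 := norm_ne_zero_iff.mpr h0
  set e := ((‖f‖ : ℂ)⁻¹) • f with he
  have he1 : ‖e‖ = 1 := by rw [he, norm_smul]; simp [hn]
  have hfe : f = (‖f‖ : ℂ) • e := by
    rw [he, smul_smul, mul_inv_cancel₀ (by exact_mod_cast hn), one_smul]
  have h1 : ∫⁻ ξ in {ξ : Rd d | K < ‖ξ‖}, ‖fhat e ξ‖ₑ ^ 2 ≤ ENNReal.ofReal θ := by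
    refine le_trans ?_ h
    exact le_iSup₂_of_le e (R.smul_mem _ hf) (le_iSup_of_le he1 le_rfl)
  have h2 : ∀ ξ, ‖fhat f ξ‖ₑ ^ 2 = ENNReal.ofReal (‖f‖ ^ 2) * ‖fhat e ξ‖ₑ ^ 2 := fun ξ => by
    conv_lhs => rw [hfe]
    rw [fhat_smul, enorm_mul, mul_pow, ENNReal.ofReal_pow (norm_nonneg _)]
    congr 2
    rw [← ofReal_norm]; simp
  simp_rw [h2]
  rw [lintegral_const_mul' _ _ ENNReal.ofReal_ne_top, mul_comm]
  gcongr

/-! ### From the maximum point to a pointwise sampling inequality -/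

theorem tendsto_fourier_cocompact (g : Rd d → ℂ) :
    Filter.Tendsto (𝓕 g) (Filter.cocompact (Rd d)) (nhds 0) :=
  tendsto_integral_exp_inner_smul_cocompact g

/-- Near a maximum point of `|F(y) h(y - x₀)|`, the product decays at most like a cosine. -/
theorem cos_mul_norm_le_of_isMax {D : Set (Rd d)} (hD : IsCompact D)
    {f : Lp ℂ 2 (volume : Measure (Rd d))} (hf : f ∈ L2On D) {ψ : 𝓢(Rd d, ℂ)} {κ : ℝ}
    (hψ : ∀ x, ψ x ≠ 0 → ∃ u ∈ D, x = κ • u) (hκ : 0 ≤ κ) {ρ : ℝ} (hρ : 0 < ρ)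
    (hρκ : (1 + κ) * ρ < 1 / 2) {x₀ y₀ w : Rd d}
    (hmax : ∀ y, ‖fhat f y * 𝓕 ψ (y - x₀)‖ ≤ ‖fhat f y₀ * 𝓕 ψ (y₀ - x₀)‖)
    (hw : ∀ x ∈ D, |inner ℝ x w| ≤ ρ) :
    Real.cos (2 * Real.pi * ((1 + κ) * ρ)) * ‖fhat f y₀ * 𝓕 ψ (y₀ - x₀)‖ ≤
      ‖fhat f (y₀ + w) * 𝓕 ψ (y₀ + w - x₀)‖ := by
  set σ := (1 + κ) * ρ with hσ
  have hσ0 : 0 < σ := by positivity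
  have hfi := L2On.integrable hD hf
  have hfD : ∀ᵐ x, x ∉ D → f x = 0 := hf
  -- The cosine comparison asks for a spectral bound at every point of the support, so f is replaced
  -- by a representative vanishing everywhere off D.
  set f₁ : Rd d → ℂ := D.indicator (fun x => f x) with hf₁
  have hff₁ : (fun x => f x) =ᵐ[volume] f₁ := by
    filter_upwards [hfD] with x hx
    by_cases h : x ∈ D
    · simp [hf₁, h]
    · simp [hf₁, h, hx h]
  -- A product of two transforms is one integral over the product space, with frequency `p.1 + p.2`;
  -- no convolution is formed. The scaling in `θ` makes |θ| ≤ π and puts y₀ + w at parameter t = 2σ.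
  let Q : Rd d × Rd d → ℂ := fun p =>
    (Complex.exp (((-2 * Real.pi * inner ℝ p.1 y₀ : ℝ) : ℂ) * Complex.I) * f₁ p.1) *
      (Complex.exp (((-2 * Real.pi * inner ℝ p.2 (y₀ - x₀) : ℝ) : ℂ) * Complex.I) * ψ p.2)
  let θ : Rd d × Rd d → ℝ := fun p => -Real.pi * inner ℝ (p.1 + p.2) w / σ
  have hmod (a : Rd d) {g : Rd d → ℂ} (hg : Integrable g) : Integrable fun x : Rd d =>
      Complex.exp (((-2 * Real.pi * inner ℝ x a : ℝ) : ℂ) * Complex.I) * g x := by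
    refine hg.bdd_mul (c := 1) (Continuous.aestronglyMeasurable (by fun_prop)) ?_
    exact Filter.Eventually.of_forall fun x => (Complex.norm_exp_ofReal_mul_I _).le
  have hf₁i : Integrable f₁ := hfi.congr hff₁
  have hQ : Integrable Q (volume.prod volume) :=
    (hmod y₀ hf₁i).mul_prod (hmod (y₀ - x₀) ψ.integrable)
  have hθm : Measurable θ := by
    have : Continuous θ := by fun_prop
    exact this.measurable
  have hθ : ∀ p, Q p ≠ 0 → |θ p| ≤ Real.pi := by
    intro p hp
    have h1 : f₁ p.1 ≠ 0 := fun h => hp (by simp [Q, h])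
    have h2 : ψ p.2 ≠ 0 := fun h => hp (by simp [Q, h])
    have h3 : p.1 ∈ D := by
      by_contra h
      exact h1 (by simp [hf₁, h])
    obtain ⟨u, hu, hpu⟩ := hψ _ h2
    have h4 : |inner ℝ (p.1 + p.2) w| ≤ σ := by
      rw [hpu, inner_add_left, real_inner_smul_left]
      refine (abs_add_le _ _).trans ?_
      rw [abs_mul, abs_of_nonneg hκ, hσ, add_mul, one_mul]
      gcongr
      · exact hw _ h3
      · exact hw _ hu
    simp only [θ]
    rw [abs_div, abs_mul, abs_neg, abs_of_pos Real.pi_pos, abs_of_pos hσ0, div_le_iff₀ hσ0]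
    gcongr
  have hgen (t : ℝ) : ∫ p, Q p * Complex.exp (θ p * t * Complex.I) ∂(volume.prod volume)
      = fhat f (y₀ + (t / (2 * σ)) • w) * 𝓕 ψ (y₀ + (t / (2 * σ)) • w - x₀) := by
    have e1 : fhat f (y₀ + (t / (2 * σ)) • w) = 𝓕 f₁ (y₀ + (t / (2 * σ)) • w) := by
      simp only [fhat, Real.fourier_eq']
      refine integral_congr_ae ?_
      filter_upwards [hff₁] with x hx
      rw [hx]
    rw [e1, SchwartzMap.fourier_coe]
    simp only [Real.fourier_eq', smul_eq_mul]
    rw [← integral_prod_mul]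
    refine integral_congr_ae (Filter.Eventually.of_forall fun p => ?_)
    simp only [Q, θ]
    have e2 : ∀ {a b c a' b' u v : ℂ}, a * b * c = a' * b' →
        (a * u) * (b * v) * c = (a' * u) * (b' * v) := fun {a b c a' b' u v} h => by
      linear_combination u * v * h
    refine e2 ?_
    rw [← Complex.exp_add, ← Complex.exp_add, ← Complex.exp_add]
    congr 1
    have hσC : (σ : ℂ) ≠ 0 := by exact_mod_cast hσ0.ne'
    have e4 : y₀ + (t / (2 * σ)) • w - x₀ = (y₀ - x₀) + (t / (2 * σ)) • w := by abel
    rw [e4]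
    simp only [inner_add_right, inner_add_left, real_inner_smul_right]
    push_cast
    field_simp
    ring
  have h0 : ∫ p, Q p ∂(volume.prod volume) = fhat f y₀ * 𝓕 ψ (y₀ - x₀) := by
    have := hgen 0
    simpa using this
  have hfin := cos_mul_norm_le_of_norm_le hQ hθm hθ (t := 2 * σ)
    (fun t => by rw [hgen, h0]; exact hmax _) (by rw [abs_of_pos (by positivity)]; linarith)
  rw [hgen, h0, div_self (by positivity), one_smul] at hfin
  rwa [show 2 * Real.pi * σ = Real.pi * (2 * σ) by ring]

/-- The pointwise sampling inequality behind Beurling's theorem: the value of `fhat f` at a point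
is controlled by the samples `fhat f (s z)`, weighted by a fixed rapidly decaying kernel. -/
theorem enorm_fhat_sq_le_lintegral {D : Set (Rd d)} (hD : IsCompact D)
    {f : Lp ℂ 2 (volume : Measure (Rd d))} (hf : f ∈ L2On D) {ψ : 𝓢(Rd d, ℂ)} {κ : ℝ}
    (hψ : ∀ x, ψ x ≠ 0 → ∃ u ∈ D, x = κ • u) (hκ : 0 ≤ κ) (hψ0 : 𝓕 ψ 0 = 1) {δ η r : ℝ}
    (hρ : 0 < δ + η) (hρκ : (1 + κ) * (δ + η) < 1 / 4)
    (hr : ∀ w : Rd d, ‖w‖ < r → ∀ x ∈ D, |inner ℝ x w| ≤ η)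
    {s : Rd d → Rd d} (hs : ∀ z, ∀ x ∈ D, |inner ℝ x (s z - z)| ≤ δ) (x₀ : Rd d) :
    ENNReal.ofReal (Real.cos (2 * Real.pi * ((1 + κ) * (δ + η))) ^ 2) *
        volume (Metric.ball (0 : Rd d) r) * ‖fhat f x₀‖ₑ ^ 2 ≤
      ∫⁻ z, ‖fhat f (s z)‖ₑ ^ 2 * ‖𝓕 ψ (s z - x₀)‖ₑ ^ 2 := by
  have hfi := L2On.integrable hD hf
  have hcont : Continuous fun y => ‖fhat f y * 𝓕 ψ (y - x₀)‖ := by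
    have h1 := fhat_continuous hfi
    have h2 := (𝓕 ψ).continuous
    fun_prop
  have hlim : Filter.Tendsto (fun y => ‖fhat f y * 𝓕 ψ (y - x₀)‖) (Filter.cocompact _)
      (nhds 0) := by
    have h1 : Filter.Tendsto (fhat f) (Filter.cocompact _) (nhds 0) :=
      tendsto_fourier_cocompact _
    have h2 : Filter.Tendsto (fun y => 𝓕 ψ (y - x₀)) (Filter.cocompact _) (nhds 0) := by
      rw [SchwartzMap.fourier_coe]
      exact (tendsto_fourier_cocompact ψ).comp
        (Homeomorph.subRight x₀).isClosedEmbedding.tendsto_cocompact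
    simpa using (h1.mul h2).norm
  obtain ⟨y₀, hy₀⟩ : ∃ y₀, ∀ y, ‖fhat f y * 𝓕 ψ (y - x₀)‖ ≤ ‖fhat f y₀ * 𝓕 ψ (y₀ - x₀)‖ := by
    by_cases h : ∃ y₁, 0 < ‖fhat f y₁ * 𝓕 ψ (y₁ - x₀)‖
    · obtain ⟨y₁, hy₁⟩ := h
      refine hcont.exists_forall_ge' y₁ ?_
      filter_upwards [hlim.eventually_lt_const hy₁] with y hy using hy.le
    · push Not at h
      exact ⟨0, fun y => (h y).trans (norm_nonneg _)⟩
  set c := Real.cos (2 * Real.pi * ((1 + κ) * (δ + η))) with hc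
  have hc0 : 0 ≤ c := by
    have hpos : 0 < (1 + κ) * (δ + η) := by positivity
    apply Real.cos_nonneg_of_neg_pi_div_two_le_of_le <;> nlinarith [Real.pi_pos]
  -- s z - y₀ splits into s z - z, of size at most δ, and z - y₀, of size at most η.
  have hball : ∀ z ∈ Metric.ball y₀ r, ENNReal.ofReal (c ^ 2) * ‖fhat f x₀‖ₑ ^ 2 ≤
      ‖fhat f (s z)‖ₑ ^ 2 * ‖𝓕 ψ (s z - x₀)‖ₑ ^ 2 := by
    intro z hz
    have h1 := cos_mul_norm_le_of_isMax hD hf hψ hκ hρ (by linarith) hy₀ (w := s z - y₀) (by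
      intro x hx
      rw [show s z - y₀ = (s z - z) + (z - y₀) by abel, inner_add_right]
      refine (abs_add_le _ _).trans (add_le_add (hs z x hx) (hr _ ?_ x hx))
      simpa [dist_eq_norm] using hz)
    rw [add_sub_cancel] at h1
    have h2 : c * ‖fhat f x₀‖ ≤ ‖fhat f (s z) * 𝓕 ψ (s z - x₀)‖ := by
      refine le_trans ?_ h1
      have := hy₀ x₀
      rw [sub_self, hψ0, mul_one] at this
      gcongr
    rw [ENNReal.ofReal_pow hc0, ← mul_pow, ← mul_pow, ← enorm_mul, ← ofReal_norm, ← ofReal_norm,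
      ← ENNReal.ofReal_mul hc0]
    gcongr
  calc ENNReal.ofReal (c ^ 2) * volume (Metric.ball (0 : Rd d) r) * ‖fhat f x₀‖ₑ ^ 2
      = ∫⁻ _ in Metric.ball y₀ r, ENNReal.ofReal (c ^ 2) * ‖fhat f x₀‖ₑ ^ 2 := by
        rw [setLIntegral_const, Measure.addHaar_ball_center volume y₀]
        ring
    _ ≤ ∫⁻ z in Metric.ball y₀ r, ‖fhat f (s z)‖ₑ ^ 2 * ‖𝓕 ψ (s z - x₀)‖ₑ ^ 2 :=
        setLIntegral_mono' measurableSet_ball hball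
    _ ≤ _ := setLIntegral_le_lintegral _ _

/-! ### Integrated sampling inequalities -/

/-- One factor of `h` is bounded and the other supplies decay of order d + 1, which is integrable; a
shift by at most r costs a factor (1 + r)^(d+1). -/
theorem exists_integrable_majorant (h : 𝓢(Rd d, ℂ)) {r : ℝ} (hr : 0 ≤ r) :
    ∃ Φ : Rd d → ℝ≥0∞, Measurable Φ ∧ ∫⁻ x, Φ x ≠ ∞ ∧
      ∀ u v, ‖u - v‖ ≤ r → ‖h u‖ₑ ^ 2 ≤ Φ v := by
  set C := (2 ^ (d + 1) * (Finset.Iic (d + 1, 0)).sup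
    (fun m => SchwartzMap.seminorm ℝ m.1 m.2) h) with hC
  have hdec (u : Rd d) : (1 + ‖u‖) ^ (d + 1) * ‖h u‖ ≤ C := by
    have := SchwartzMap.one_add_le_sup_seminorm_apply (𝕜 := ℝ) (m := (d + 1, 0)) (k := d + 1)
      (n := 0) le_rfl le_rfl h u
    simpa using this
  have hC0 : 0 ≤ C := (by positivity : 0 ≤ (1 + ‖(0 : Rd d)‖) ^ (d + 1) * ‖h 0‖).trans (hdec 0)
  refine ⟨fun v => ENNReal.ofReal (C ^ 2 * (1 + r) ^ (d + 1)) *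
    ENNReal.ofReal ((1 + ‖v‖) ^ (-((d + 1 : ℕ) : ℝ))), by fun_prop, ?_, ?_⟩
  · rw [lintegral_const_mul' _ _ ENNReal.ofReal_ne_top]
    refine ENNReal.mul_ne_top ENNReal.ofReal_ne_top (finite_integral_one_add_norm ?_).ne
    simp
  · intro u v huv
    beta_reduce
    rw [← ofReal_norm, ← ENNReal.ofReal_pow (norm_nonneg _), ← ENNReal.ofReal_mul (by positivity)]
    refine ENNReal.ofReal_le_ofReal ?_
    rw [Real.rpow_neg (by positivity), Real.rpow_natCast, ← div_eq_mul_inv,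
      le_div_iff₀ (by positivity)]
    have h1 : 1 + ‖v‖ ≤ (1 + r) * (1 + ‖u‖) := by
      have : ‖v‖ ≤ ‖u‖ + ‖u - v‖ := by
        have := norm_sub_le u (u - v)
        simpa using this
      nlinarith [norm_nonneg u]
    have h2 : ‖h u‖ ≤ C := by
      refine le_trans ?_ (hdec u)
      refine le_mul_of_one_le_left (norm_nonneg _) (one_le_pow₀ ?_)
      linarith [norm_nonneg u]
    calc ‖h u‖ ^ 2 * (1 + ‖v‖) ^ (d + 1)
        ≤ ‖h u‖ ^ 2 * ((1 + r) * (1 + ‖u‖)) ^ (d + 1) := by gcongr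
      _ = ‖h u‖ * ((1 + ‖u‖) ^ (d + 1) * ‖h u‖) * (1 + r) ^ (d + 1) := by rw [mul_pow]; ring
      _ ≤ C * C * (1 + r) ^ (d + 1) := by gcongr; exact hdec u
      _ = _ := by ring

/-- A Plancherel–Pólya type bound for samples taken at bounded distance. -/
theorem lintegral_sample_le {F : Rd d → ℂ} (hF : Continuous F) {h : Rd d → ℂ} {C : ℝ≥0∞} {Φ : Rd d → ℝ≥0∞} (hΦ : Measurable Φ) {r : ℝ}
    (hΦh : ∀ u v, ‖u - v‖ ≤ r → ‖h u‖ₑ ^ 2 ≤ Φ v)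
    (hrep : ∀ x, C * ‖F x‖ₑ ^ 2 ≤ ∫⁻ y, ‖F y‖ₑ ^ 2 * ‖h (y - x)‖ₑ ^ 2)
    {s : Rd d → Rd d} (hs : Measurable s) (hsr : ∀ z, ‖s z - z‖ ≤ r) :
    C * ∫⁻ z, ‖F (s z)‖ₑ ^ 2 ≤ (∫⁻ x, Φ x) * ∫⁻ y, ‖F y‖ₑ ^ 2 := by
  have hFm : Measurable fun y => ‖F y‖ₑ ^ 2 := by fun_prop
  calc C * ∫⁻ z, ‖F (s z)‖ₑ ^ 2 = ∫⁻ z, C * ‖F (s z)‖ₑ ^ 2 :=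
        (lintegral_const_mul _ (hFm.comp hs)).symm
    _ ≤ ∫⁻ z, ∫⁻ y, ‖F y‖ₑ ^ 2 * Φ (y - z) := by
        -- The inequality is used at x = s z; the majorant then replaces the shift by s z with a
        -- shift by z, which makes the swapped integral translation invariant.
        refine lintegral_mono fun z => (hrep (s z)).trans (lintegral_mono fun y => ?_)
        gcongr
        refine hΦh _ _ ?_
        rw [show y - s z - (y - z) = -(s z - z) by abel, norm_neg]
        exact hsr z
    _ = ∫⁻ y, ∫⁻ z, ‖F y‖ₑ ^ 2 * Φ (y - z) :=
        lintegral_lintegral_swap (by fun_prop)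
    _ = ∫⁻ y, ‖F y‖ₑ ^ 2 * ∫⁻ x, Φ x := by
        refine lintegral_congr fun y => ?_
        rw [lintegral_const_mul _ (by fun_prop), lintegral_sub_left_eq_self]
    _ = _ := by rw [lintegral_mul_const _ hFm, mul_comm]

/-- If |x| ≤ K and |s z| > K + L then |s z - x| > L, so far samples see only the tail of `h`. -/
theorem lintegral_ball_le_lintegral_sample {F : Rd d → ℂ} (hF : Continuous F) {h : Rd d → ℂ}
    (hh : Continuous h) {C : ℝ≥0∞} {s : Rd d → Rd d} (hs : Measurable s)
    (hrep : ∀ x, C * ‖F x‖ₑ ^ 2 ≤ ∫⁻ z, ‖F (s z)‖ₑ ^ 2 * ‖h (s z - x)‖ₑ ^ 2) (K L : ℝ) :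
    C * ∫⁻ x in Metric.closedBall 0 K, ‖F x‖ₑ ^ 2 ≤
      (∫⁻ u, ‖h u‖ₑ ^ 2) * (∫⁻ z in s ⁻¹' Metric.closedBall 0 (K + L), ‖F (s z)‖ₑ ^ 2) +
        (∫⁻ u in {u | L < ‖u‖}, ‖h u‖ₑ ^ 2) * ∫⁻ z, ‖F (s z)‖ₑ ^ 2 := by
  have hFm : Measurable fun y => ‖F y‖ₑ ^ 2 := by fun_prop
  have hFsm : Measurable fun z => ‖F (s z)‖ₑ ^ 2 := hFm.comp hs
  have hF' := hF.measurable
  have hh' := hh.measurable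
  set S := s ⁻¹' Metric.closedBall (0 : Rd d) (K + L) with hS
  have hSm : MeasurableSet S := hs measurableSet_closedBall
  have hswap (T : Set (Rd d)) : ∫⁻ z in T, ∫⁻ x in Metric.closedBall 0 K,
      ‖F (s z)‖ₑ ^ 2 * ‖h (s z - x)‖ₑ ^ 2 =
      ∫⁻ x in Metric.closedBall 0 K, ∫⁻ z in T, ‖F (s z)‖ₑ ^ 2 * ‖h (s z - x)‖ₑ ^ 2 :=
    lintegral_lintegral_swap (by fun_prop)
  have hinner (z : Rd d) : ∫⁻ x in Metric.closedBall 0 K, ‖F (s z)‖ₑ ^ 2 * ‖h (s z - x)‖ₑ ^ 2 =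
      ‖F (s z)‖ₑ ^ 2 * ∫⁻ x in Metric.closedBall 0 K, ‖h (s z - x)‖ₑ ^ 2 :=
    lintegral_const_mul _ (by fun_prop)
  calc C * ∫⁻ x in Metric.closedBall 0 K, ‖F x‖ₑ ^ 2
      = ∫⁻ x in Metric.closedBall 0 K, C * ‖F x‖ₑ ^ 2 := (lintegral_const_mul _ hFm).symm
    _ ≤ ∫⁻ x in Metric.closedBall 0 K, ((∫⁻ z in S, ‖F (s z)‖ₑ ^ 2 * ‖h (s z - x)‖ₑ ^ 2) +
          ∫⁻ z in Sᶜ, ‖F (s z)‖ₑ ^ 2 * ‖h (s z - x)‖ₑ ^ 2) := by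
        refine lintegral_mono fun x => ?_
        rw [lintegral_add_compl _ hSm]
        exact hrep x
    _ = (∫⁻ x in Metric.closedBall 0 K, ∫⁻ z in S, ‖F (s z)‖ₑ ^ 2 * ‖h (s z - x)‖ₑ ^ 2) +
          ∫⁻ x in Metric.closedBall 0 K, ∫⁻ z in Sᶜ, ‖F (s z)‖ₑ ^ 2 * ‖h (s z - x)‖ₑ ^ 2 :=
        lintegral_add_left (Measurable.lintegral_prod_right' (f := fun p : Rd d × Rd d =>
          ‖F (s p.2)‖ₑ ^ 2 * ‖h (s p.2 - p.1)‖ₑ ^ 2) (by fun_prop)) _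
    _ ≤ _ := by
        rw [← hswap, ← hswap]
        refine add_le_add ?_ ?_
        · rw [mul_comm, ← lintegral_mul_const _ hFsm]
          refine lintegral_mono fun z => ?_
          rw [hinner]
          refine mul_le_mul' le_rfl ?_
          refine (setLIntegral_le_lintegral _ _).trans ?_
          rw [lintegral_sub_left_eq_self (fun u => ‖h u‖ₑ ^ 2)]
        · rw [mul_comm, ← lintegral_mul_const _ hFsm]
          refine le_trans (setLIntegral_mono' (g := fun z => ‖F (s z)‖ₑ ^ 2 *
            ∫⁻ u in {u | L < ‖u‖}, ‖h u‖ₑ ^ 2) hSm.compl fun z hz => ?_)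
            (setLIntegral_le_lintegral _ _)
          rw [hinner]
          refine mul_le_mul' le_rfl ?_
          have hLm : MeasurableSet {u : Rd d | L < ‖u‖} :=
            (isOpen_lt continuous_const continuous_norm).measurableSet
          rw [← lintegral_indicator hLm, ← lintegral_indicator measurableSet_closedBall,
            ← lintegral_sub_left_eq_self ({u : Rd d | L < ‖u‖}.indicator _) (s z)]
          refine lintegral_mono fun x => ?_
          by_cases hx : x ∈ Metric.closedBall (0 : Rd d) K
          · have : s z - x ∈ {u : Rd d | L < ‖u‖} := by
              have h1 : K + L < ‖s z‖ := by simpa [hS] using hz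
              have h2 : ‖x‖ ≤ K := by simpa using hx
              have h3 := norm_sub_norm_le (s z) x
              show L < ‖s z - x‖
              linarith
            rw [indicator_of_mem hx, indicator_of_mem this]
          · rw [indicator_of_notMem hx]
            exact zero_le

theorem exists_lintegral_tail_le {g : Rd d → ℝ≥0∞} (hg : ∫⁻ u, g u ≠ ∞) {τ : ℝ≥0∞}
    (hτ : 0 < τ) : ∃ L : ℝ, 0 ≤ L ∧ ∫⁻ u in {u | L < ‖u‖}, g u ≤ τ := by
  have hm (n : ℕ) : MeasurableSet {u : Rd d | (n : ℝ) < ‖u‖} :=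
    (isOpen_lt continuous_const continuous_norm).measurableSet
  have hfin : IsFiniteMeasure (volume.withDensity g) := isFiniteMeasure_withDensity hg
  have h1 := tendsto_measure_iInter_atTop (μ := volume.withDensity g)
    (s := fun n : ℕ => {u : Rd d | (n : ℝ) < ‖u‖}) (fun n => (hm n).nullMeasurableSet)
    (fun m n hmn u (hu : (n : ℝ) < ‖u‖) => lt_of_le_of_lt (Nat.cast_le.mpr hmn : (m : ℝ) ≤ n) hu) ⟨0, measure_ne_top _ _⟩
  have h2 : ⋂ n : ℕ, {u : Rd d | (n : ℝ) < ‖u‖} = ∅ := by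
    ext u
    obtain ⟨n, hn⟩ := exists_nat_gt ‖u‖
    simp only [mem_iInter, mem_ofPred_eq, mem_empty_iff_false, iff_false, not_forall, not_lt]
    exact ⟨n, hn.le⟩
  rw [h2, measure_empty] at h1
  obtain ⟨n, hn⟩ := (h1.eventually_le_const hτ).exists
  refine ⟨n, n.cast_nonneg, ?_⟩
  rwa [Function.comp_apply, withDensity_apply _ (hm n)] at hn

theorem exists_schwartz_bump {r : ℝ} (hr : 0 < r) :
    ∃ ψ : 𝓢(Rd d, ℂ), 𝓕 ψ 0 = 1 ∧ ∀ x, ψ x ≠ 0 → ‖x‖ < r := by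
  let b : ContDiffBump (0 : Rd d) := ⟨r / 2, r, by positivity, by linarith⟩
  let g : Rd d → ℂ := fun x => (b.normed volume x : ℂ)
  have hgs : HasCompactSupport g :=
    (b.hasCompactSupport_normed (μ := volume)).comp_left (g := fun y : ℝ => (y : ℂ)) rfl
  have hg : ContDiff ℝ ((⊤ : ℕ∞) : WithTop ℕ∞) g := Complex.ofRealCLM.contDiff.comp b.contDiff_normed
  refine ⟨hgs.toSchwartzMap hg, ?_, fun x hx => ?_⟩
  · rw [SchwartzMap.fourier_coe, Real.fourier_eq']
    simp only [inner_zero_right, mul_zero, Complex.ofReal_zero, zero_mul, Complex.exp_zero,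
      one_smul]
    have : ∫ x, ((b.normed volume x : ℝ) : ℂ) = 1 := by
      rw [integral_complex_ofReal, b.integral_normed, Complex.ofReal_one]
    exact this
  · have h1 : b.normed volume x ≠ 0 := fun h => hx (by
      show ((b.normed volume x : ℝ) : ℂ) = 0
      rw [h, Complex.ofReal_zero])
    have h2 : x ∈ Function.support (b.normed volume) := h1
    rw [b.support_normed_eq] at h2
    simpa using h2

/-! ### Geometry of the polar gauge -/

namespace IsCenteredSymmetricConvexBody

variable {D : Set (Rd d)}

theorem exists_closedBall_subset (hD : IsCenteredSymmetricConvexBody D) :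
    ∃ r, 0 < r ∧ Metric.closedBall 0 r ⊆ D :=
  Metric.nhds_basis_closedBall.mem_iff.mp (mem_interior_iff_mem_nhds.mp hD.zero_mem_interior)

theorem exists_norm_le (hD : IsCenteredSymmetricConvexBody D) :
    ∃ M, 0 < M ∧ ∀ x ∈ D, ‖x‖ ≤ M :=
  hD.isCompact.isBounded.exists_pos_norm_le

theorem polarSet_mem_nhds (hD : IsCenteredSymmetricConvexBody D) :
    polarSet D ∈ nhds (0 : Rd d) := by
  obtain ⟨M, hM, hDM⟩ := hD.exists_norm_le
  refine Filter.mem_of_superset (Metric.closedBall_mem_nhds 0 (inv_pos.mpr hM)) fun z hz x hx => ?_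
  have hz' : ‖z‖ ≤ M⁻¹ := by simpa using hz
  calc inner ℝ x z ≤ ‖x‖ * ‖z‖ := real_inner_le_norm x z
    _ ≤ M * M⁻¹ := by gcongr; exact hDM x hx
    _ = 1 := mul_inv_cancel₀ hM.ne'

end IsCenteredSymmetricConvexBody

theorem convex_polarSet (D : Set (Rd d)) : Convex ℝ (polarSet D) := by
  intro y hy z hz a b ha hb hab x hx
  rw [inner_add_right, real_inner_smul_right, real_inner_smul_right, ← hab]
  have h1 := mul_le_mul_of_nonneg_left (hy x hx) ha
  have h2 := mul_le_mul_of_nonneg_left (hz x hx) hb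
  linarith

namespace IsCenteredSymmetricConvexBody

variable {D : Set (Rd d)}

theorem continuous_gauge_polarSet (hD : IsCenteredSymmetricConvexBody D) :
    Continuous (gauge (polarSet D)) :=
  continuous_gauge (convex_polarSet D) hD.polarSet_mem_nhds

theorem abs_inner_le_gauge (hD : IsCenteredSymmetricConvexBody D) {x : Rd d} (hx : x ∈ D)
    (w : Rd d) : |inner ℝ x w| ≤ gauge (polarSet D) w := by
  have key : ∀ x ∈ D, inner ℝ x w ≤ gauge (polarSet D) w := by
    intro x hx
    refine le_csInf (absorbent_nhds_zero hD.polarSet_mem_nhds).gauge_set_nonempty ?_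
    rintro a ⟨ha, z, hz, rfl⟩
    simp only [real_inner_smul_right]
    exact mul_le_of_le_one_right (le_of_lt ha) (hz x hx)
  refine abs_le'.mpr ⟨key x hx, ?_⟩
  rw [← inner_neg_left]
  exact key _ (hD.symmetric x hx)

end IsCenteredSymmetricConvexBody

/-- Test against the multiple of w of norm r. This turns bounds in the polar norm into Euclidean
ones. -/
theorem mul_norm_le_of_abs_inner_le {D : Set (Rd d)} {r δ : ℝ} (hr : 0 < r)
    (hrD : Metric.closedBall 0 r ⊆ D) {w : Rd d} (hw : ∀ x ∈ D, |inner ℝ x w| ≤ δ) :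
    r * ‖w‖ ≤ δ := by
  by_cases h : w = 0
  · subst h
    simpa using hw 0 (hrD (by simpa using hr.le))
  have hn : ‖w‖ ≠ 0 := norm_ne_zero_iff.mpr h
  have h1 := hw ((r / ‖w‖) • w) (hrD (by
    simp [norm_smul, abs_of_pos hr, div_mul_cancel₀ _ hn]))
  rw [real_inner_smul_left, real_inner_self_eq_norm_sq] at h1
  refine le_trans (le_of_eq ?_) ((le_abs_self _).trans h1)
  field_simp

/-! ### The uniform lower bound -/

/-- A lower sampling bound, uniform over measurable sample selections `s` with
`s z - z ∈ (1 - ε)/4 • D°`, for functions whose Fourier transform is concentrated on a ball. -/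
theorem exists_sampling_bound {D : Set (Rd d)} (hD : IsCenteredSymmetricConvexBody D) {ε : ℝ}
    (hε : 0 < ε) (hε1 : ε ≤ 1) :
    ∃ A : ℝ, 0 < A ∧ ∃ L : ℝ, 0 ≤ L ∧ ∀ f ∈ L2On D, ∀ K : ℝ,
      ∫⁻ ξ in {ξ : Rd d | K < ‖ξ‖}, ‖fhat f ξ‖ₑ ^ 2 ≤
        ENNReal.ofReal (1 / 4) * ENNReal.ofReal (‖f‖ ^ 2) →
      ∀ s : Rd d → Rd d, Measurable s →
        (∀ z, ∀ x ∈ D, |inner ℝ x (s z - z)| ≤ (1 - ε) / 4) →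
        ENNReal.ofReal (A * ‖f‖ ^ 2) ≤
          ∫⁻ z in s ⁻¹' Metric.closedBall 0 (K + L), ‖fhat f (s z)‖ₑ ^ 2 := by
  obtain ⟨r₁, hr₁, hr₁D⟩ := hD.exists_closedBall_subset
  obtain ⟨M, hM, hDM⟩ := hD.exists_norm_le
  -- With these values (1 + κ)(δ + η) = (1 - ε²/4)/4, just below the threshold 1/4.
  set κ := ε / 2 with hκ
  set δ := (1 - ε) / 4 with hδ
  set η := ε / 8 with hη
  have hκ0 : 0 < κ := by positivity
  have hδ0 : 0 ≤ δ := by rw [hδ]; linarith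
  have hη0 : 0 < η := by positivity
  have hρκ : (1 + κ) * (δ + η) < 1 / 4 := by rw [hκ, hδ, hη]; nlinarith
  obtain ⟨ψ, hψ0, hψs⟩ := exists_schwartz_bump (d := d) (mul_pos hκ0 hr₁)
  have hψ : ∀ x, ψ x ≠ 0 → ∃ u ∈ D, x = κ • u := by
    intro x hx
    refine ⟨κ⁻¹ • x, hr₁D ?_, by rw [smul_smul, mul_inv_cancel₀ hκ0.ne', one_smul]⟩
    have := hψs x hx
    rw [mem_closedBall_zero_iff, norm_smul, norm_inv, Real.norm_of_nonneg hκ0.le,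
      inv_mul_le_iff₀ hκ0]
    exact this.le
  set r₀ := η / M with hr₀
  have hr₀pos : 0 < r₀ := by positivity
  have hr : ∀ w : Rd d, ‖w‖ < r₀ → ∀ x ∈ D, |inner ℝ x w| ≤ η := by
    intro w hw x hx
    refine (abs_real_inner_le_norm x w).trans ?_
    calc ‖x‖ * ‖w‖ ≤ M * r₀ := by gcongr; exact hDM x hx
      _ = η := by rw [hr₀]; field_simp
  obtain ⟨Φ, hΦm, hΦfin, hΦ⟩ := exists_integrable_majorant (𝓕 ψ) (r := δ / r₁) (by positivity)
  set C : ℝ≥0∞ := ENNReal.ofReal (Real.cos (2 * Real.pi * ((1 + κ) * (δ + η))) ^ 2) *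
        volume (Metric.ball (0 : Rd d) r₀) with hC
  have hcos : 0 < Real.cos (2 * Real.pi * ((1 + κ) * (δ + η))) := by
    have hpos : 0 < (1 + κ) * (δ + η) := by positivity
    apply Real.cos_pos_of_mem_Ioo
    constructor <;> nlinarith [Real.pi_pos]
  have hC0 : C ≠ 0 := mul_ne_zero (ENNReal.ofReal_pos.mpr (pow_pos hcos 2)).ne'
    (Metric.measure_ball_pos volume _ hr₀pos).ne'
  have hCtop : C ≠ ∞ := ENNReal.mul_ne_top ENNReal.ofReal_ne_top measure_ball_lt_top.ne
  have hHfin : ∫⁻ u, ‖𝓕 ψ u‖ₑ ^ 2 ≠ ∞ := by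
    refine ne_top_of_le_ne_top hΦfin (lintegral_mono fun u => hΦ u u ?_)
    rw [sub_self, norm_zero]
    positivity
  set c := C.toReal with hc
  set I := (∫⁻ x, Φ x).toReal with hI
  set H := (∫⁻ u, ‖𝓕 ψ u‖ₑ ^ 2).toReal with hH
  have hc0 : 0 < c := ENNReal.toReal_pos hC0 hCtop
  have hI0 : 0 ≤ I := ENNReal.toReal_nonneg
  have hH0 : 0 ≤ H := ENNReal.toReal_nonneg
  -- Chosen so that τ times the Plancherel–Pólya bound (I/c)‖f‖² is at most (c/4)‖f‖².
  set τ := c ^ 2 / (4 * (I + 1)) with hτ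
  have hτ0 : 0 < τ := by positivity
  obtain ⟨L, hL0, hL⟩ := exists_lintegral_tail_le hHfin (ENNReal.ofReal_pos.mpr hτ0)
  refine ⟨c / (2 * (H + 1)), by positivity, L, hL0, fun f hf K hK s hs hsD => ?_⟩
  have hfi := L2On.integrable hD.isCompact hf
  have hF := fhat_continuous hfi
  have hrep (s : Rd d → Rd d) (hs : ∀ z, ∀ x ∈ D, |inner ℝ x (s z - z)| ≤ δ) (x : Rd d) :
      C * ‖fhat f x‖ₑ ^ 2 ≤ ∫⁻ z, ‖fhat f (s z)‖ₑ ^ 2 * ‖𝓕 ψ (s z - x)‖ₑ ^ 2 :=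
    enorm_fhat_sq_le_lintegral hD.isCompact hf hψ hκ0.le hψ0 (by positivity) hρκ hr hs x
  clear_value C
  -- Taking every point as its own sample gives the reproducing inequality behind the
  -- Plancherel–Pólya bound.
  have hrep_id := hrep id (fun z x _ => by simpa using hδ0)
  have hupper := lintegral_sample_le hF hΦm hΦ hrep_id hs (fun z => by
    rw [le_div_iff₀ hr₁, mul_comm]
    exact mul_norm_le_of_abs_inner_le hr₁ hr₁D (hsD z))
  have hlower := lintegral_ball_le_lintegral_sample hF (𝓕 ψ).continuous hs (hrep s hsD) K L
  have hplanch := lintegral_enorm_fhat_sq hfi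
  have hsplit : (∫⁻ x in Metric.closedBall 0 K, ‖fhat f x‖ₑ ^ 2) +
      (∫⁻ ξ in {ξ : Rd d | K < ‖ξ‖}, ‖fhat f ξ‖ₑ ^ 2) = ENNReal.ofReal (‖f‖ ^ 2) := by
    have : {ξ : Rd d | K < ‖ξ‖} = (Metric.closedBall 0 K)ᶜ := by
      ext ξ
      simp
    rw [this, lintegral_add_compl _ measurableSet_closedBall, hplanch]
  set Z := ∫⁻ z in s ⁻¹' Metric.closedBall 0 (K + L), ‖fhat f (s z)‖ₑ ^ 2 with hZ
  set U := ∫⁻ z, ‖fhat f (s z)‖ₑ ^ 2 with hU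
  set T := ∫⁻ ξ in {ξ : Rd d | K < ‖ξ‖}, ‖fhat f ξ‖ₑ ^ 2 with hT
  set P := ∫⁻ x in Metric.closedBall 0 K, ‖fhat f x‖ₑ ^ 2 with hP
  rw [hplanch] at hupper
  by_cases hZtop : Z = ∞
  · rw [hZtop]; exact le_top
  have hUtop : U ≠ ∞ := by
    intro h
    rw [h, ENNReal.mul_top hC0, top_le_iff] at hupper
    exact ENNReal.mul_ne_top hΦfin ENNReal.ofReal_ne_top hupper
  have hPtop : P ≠ ∞ := ne_top_of_le_ne_top ENNReal.ofReal_ne_top (hsplit ▸ le_self_add)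
  have hTtop : T ≠ ∞ := ne_top_of_le_ne_top ENNReal.ofReal_ne_top (hsplit ▸ le_add_self)
  have hm0 : 0 ≤ ‖f‖ ^ 2 := by positivity
  have e1 : c * U.toReal ≤ I * ‖f‖ ^ 2 := by
    have := ENNReal.toReal_mono (ENNReal.mul_ne_top hΦfin ENNReal.ofReal_ne_top) hupper
    rwa [ENNReal.toReal_mul, ENNReal.toReal_mul, ENNReal.toReal_ofReal hm0] at this
  have e2 : c * P.toReal ≤ H * Z.toReal + τ * U.toReal := by
    have h1 := hlower.trans (add_le_add_right (mul_le_mul' hL le_rfl) _)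
    have := ENNReal.toReal_mono (ENNReal.add_ne_top.mpr ⟨ENNReal.mul_ne_top hHfin hZtop,
      ENNReal.mul_ne_top ENNReal.ofReal_ne_top hUtop⟩) h1
    rwa [ENNReal.toReal_add (ENNReal.mul_ne_top hHfin hZtop)
      (ENNReal.mul_ne_top ENNReal.ofReal_ne_top hUtop), ENNReal.toReal_mul, ENNReal.toReal_mul,
      ENNReal.toReal_mul, ENNReal.toReal_ofReal hτ0.le] at this
  have e3 : P.toReal + T.toReal = ‖f‖ ^ 2 := by
    rw [← ENNReal.toReal_add hPtop hTtop, hsplit, ENNReal.toReal_ofReal hm0]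
  have e4 : T.toReal ≤ 1 / 4 * ‖f‖ ^ 2 := by
    have := ENNReal.toReal_mono (ENNReal.mul_ne_top ENNReal.ofReal_ne_top ENNReal.ofReal_ne_top) hK
    rwa [ENNReal.toReal_mul, ENNReal.toReal_ofReal hm0, ENNReal.toReal_ofReal (by norm_num)] at this
  have e5 : τ * U.toReal ≤ c / 4 * ‖f‖ ^ 2 := by
    have h1 : τ * U.toReal = c * (c * U.toReal) / (4 * (I + 1)) := by rw [hτ]; ring
    rw [h1, div_le_iff₀ (by positivity)]
    calc c * (c * U.toReal) ≤ c * (I * ‖f‖ ^ 2) := by gcongr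
      _ ≤ c * ((I + 1) * ‖f‖ ^ 2) := by gcongr; linarith
      _ = _ := by ring
  -- The ball carries at least 3c/4 of ‖f‖² and the far samples cost at most c/4, leaving c/2.
  have e6 : c / 2 * ‖f‖ ^ 2 ≤ (H + 1) * Z.toReal := by
    have hZ0 : 0 ≤ Z.toReal := ENNReal.toReal_nonneg
    nlinarith
  refine ENNReal.ofReal_le_of_le_toReal ?_
  rw [div_mul_eq_mul_div, div_le_iff₀ (by positivity)]
  linarith

/-! ### Nearest points and Voronoi weights -/

/-- A measurable selection of nearest points of `Ω`. -/
theorem exists_measurable_nearest {D : Set (Rd d)} (hD : IsCenteredSymmetricConvexBody D)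
    {Ω : Set (Rd d)} (hΩ : IsClosed Ω) (hΩc : Ω.Countable) {δ : ℝ}
    (hgap : gap (polarSet D) Ω ≤ (δ : EReal)) :
    ∃ s : Rd d → Rd d, Measurable s ∧
      ∀ z, s z ∈ Ω ∧ z ∈ voronoiRegion (polarSet D) Ω (s z) ∧ gauge (polarSet D) (s z - z) ≤ δ := by
  have hcg := hD.continuous_gauge_polarSet
  have hinf (z : Rd d) : ⨅ ω ∈ Ω, ((gauge (polarSet D) (ω - z) : ℝ) : EReal) ≤ δ :=
    (le_iSup (fun z : Rd d => ⨅ ω ∈ Ω, ((gauge (polarSet D) (ω - z) : ℝ) : EReal)) z).trans hgap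
  have hne : Ω.Nonempty := by
    by_contra h
    rw [not_nonempty_iff_eq_empty] at h
    have := hinf 0
    simp [h] at this
  obtain ⟨r, hr, hrD⟩ := hD.exists_closedBall_subset
  have hnorm (w : Rd d) : r * ‖w‖ ≤ gauge (polarSet D) w :=
    mul_norm_le_of_abs_inner_le hr hrD fun x hx => hD.abs_inner_le_gauge hx w
  have hnear (z : Rd d) : ∃ ω ∈ Ω, z ∈ voronoiRegion (polarSet D) Ω ω := by
    obtain ⟨ω₀, hω₀⟩ := hne
    -- The gauge dominates a multiple of the Euclidean norm, so it is coercive and its infimum over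
    -- the closed set Ω is attained.
    have hev : ∀ᶠ ω in Filter.cocompact (Rd d) ⊓ Filter.principal Ω,
        gauge (polarSet D) (ω₀ - z) ≤ gauge (polarSet D) (ω - z) := by
      refine Filter.Eventually.filter_mono inf_le_left ?_
      have h1 : Filter.Tendsto (fun ω : Rd d => ‖ω‖) (Filter.cocompact (Rd d)) Filter.atTop :=
        tendsto_norm_cocompact_atTop
      filter_upwards [h1.eventually_ge_atTop (gauge (polarSet D) (ω₀ - z) / r + ‖z‖)] with ω hω
      refine le_trans ?_ (hnorm _)
      have h2 := norm_sub_norm_le ω z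
      rw [← div_le_iff₀' hr]
      linarith
    obtain ⟨ω, hω, hmin⟩ := (hcg.comp (continuous_sub_right z)).continuousOn.exists_isMinOn'
      hΩ hω₀ hev
    exact ⟨ω, hω, fun l hl _ => hmin hl⟩
  obtain ⟨e, he⟩ := hΩc.exists_eq_range hne
  have hex (z : Rd d) : ∃ n, z ∈ voronoiRegion (polarSet D) Ω (e n) := by
    obtain ⟨ω, hω, hz⟩ := hnear z
    rw [he] at hω
    obtain ⟨n, rfl⟩ := hω
    exact ⟨n, hz⟩
  have hclosed (ω : Rd d) : IsClosed (voronoiRegion (polarSet D) Ω ω) := by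
    simp only [voronoiRegion, ofPred_forall]
    refine isClosed_iInter fun l => isClosed_iInter fun _ => isClosed_iInter fun _ => ?_
    exact isClosed_le (hcg.comp (by fun_prop)) (hcg.comp (by fun_prop))
  classical
  -- Ties go to the first index in an enumeration of Ω; measurability follows because Voronoi
  -- regions are closed.
  refine ⟨fun z => e (Nat.find (hex z)),
    Measurable.find (f := fun n _ => e n) (fun n => measurable_const)
      (fun n => (hclosed (e n)).measurableSet) hex, fun z => ?_⟩
  have hmem : e (Nat.find (hex z)) ∈ Ω := he.symm.subset (mem_range_self _)
  have hv := Nat.find_spec (hex z)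
  refine ⟨hmem, hv, ?_⟩
  have hle : ((gauge (polarSet D) (e (Nat.find (hex z)) - z) : ℝ) : EReal) ≤
      ⨅ ω ∈ Ω, ((gauge (polarSet D) (ω - z) : ℝ) : EReal) := by
    refine le_iInf₂ fun l hl => EReal.coe_le_coe_iff.mpr ?_
    by_cases h : l = e (Nat.find (hex z))
    · rw [h]
    · exact hv l hl h
  exact EReal.coe_le_coe_iff.mp (hle.trans (hinf z))

/-- The fibres of `s` are disjoint and each lies in the Voronoi region of its point; shared
boundaries can only enlarge the right side. -/
theorem lintegral_preimage_le_tsum_voronoiWeight {B Ω : Set (Rd d)} (hΩ : Ω.Countable)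
    {s : Rd d → Rd d} (hs : Measurable s) (hsΩ : ∀ z, s z ∈ Ω ∧ z ∈ voronoiRegion B Ω (s z))
    (g : Rd d → ℝ≥0∞) (S : Set (Rd d)) :
    ∫⁻ z in s ⁻¹' S, g (s z) ≤ ∑' ω : ↥(Ω ∩ S), voronoiWeight B Ω (ω : Rd d) * g ω := by
  have h1 : s ⁻¹' S = ⋃ ω ∈ Ω ∩ S, s ⁻¹' {ω} := by
    ext z
    simp [(hsΩ z).1]
  rw [h1, lintegral_biUnion (hΩ.mono inter_subset_left)
    (fun ω _ => hs (measurableSet_singleton ω))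
    (fun a _ b _ hab => Disjoint.preimage s (disjoint_singleton.mpr hab))]
  refine ENNReal.tsum_le_tsum fun ω => ?_
  rw [setLIntegral_congr_fun (hs (measurableSet_singleton (ω : Rd d)))
    (g := fun _ => g ω) (fun z (hz : s z = ω) => by simp only [hz]), setLIntegral_const, mul_comm]
  refine mul_le_mul' (measure_mono fun z (hz : s z = ω) => ?_) le_rfl
  exact hz ▸ (hsΩ z).2

end

/-! ### Conclusion -/

theorem corollary1p4 {d : ℕ} (D : Set (Rd d)) (hD : IsCenteredSymmetricConvexBody D)
    (ε : ℝ) (hε : 0 < ε) :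
    ∃ A : ℝ, 0 < A ∧
      ∀ κ : ℝ → ℝ, ∃ c : ℝ, 0 < c ∧
        ∀ (α : ℝ) (R : ℕ → Submodule ℂ (Lp ℂ 2 (volume : Measure (Rd d)))),
          0 < α → (∀ N : ℕ, 1 ≤ N → R N ≤ L2On D) → HasResidualDecayWith R α κ →
            ∀ Ω : Set (Rd d), IsClosed Ω → Ω.Countable →
              gap (polarSet D) Ω ≤ (((1 - ε) / 4 : ℝ) : EReal) →
                ∀ N : ℕ, 1 ≤ N → ∀ f ∈ R N,
                  ENNReal.ofReal (A * ‖f‖ ^ 2) ≤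
                    ∑' ω : ↥(Ω ∩ Metric.closedBall (0 : Rd d) (c * (N : ℝ) ^ α)),
                      voronoiWeight (polarSet D) Ω (ω : Rd d) * ‖fhat f (ω : Rd d)‖ₑ ^ 2 := by
  -- Capping ε at 1 keeps the radius (1 - ε)/4 nonnegative and only weakens the condition on `s`.
  obtain ⟨A, hA, L, hL, hsamp⟩ :=
    exists_sampling_bound hD (lt_min hε one_pos) (min_le_right ε 1)
  -- Only the level θ = 1/4 is used. The absolute value keeps c positive for an arbitrary `κ`, and
  -- N^α ≥ 1 lets c N^α absorb the additive L.
  refine ⟨A, hA, fun κ => ⟨|κ (1 / 4)| + L + 1, by positivity, ?_⟩⟩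
  intro α R hα hR hdecay Ω hΩ hΩc hgap N hN f hf
  obtain ⟨s, hs, hsΩ⟩ := exists_measurable_nearest hD hΩ hΩc hgap
  have hN1 : (1 : ℝ) ≤ (N : ℝ) ^ α := Real.one_le_rpow (by exact_mod_cast hN) hα.le
  have htail := lintegral_fhat_tail_le
    ((le_iSup₂ (f := fun (N : ℕ) (_ : 1 ≤ N) => fourierResidual (R N) (κ (1 / 4) * (N : ℝ) ^ α))
      N hN).trans (hdecay (1 / 4) (by norm_num)).2) hf
  refine (hsamp f (hR N hN hf) _ htail s hs fun z x hx => ?_).trans ?_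
  · refine (hD.abs_inner_le_gauge hx _).trans ((hsΩ z).2.2.trans ?_)
    have := min_le_left ε 1
    linarith
  · refine le_trans (lintegral_mono_set (preimage_mono (Metric.closedBall_subset_closedBall ?_)))
      (lintegral_preimage_le_tsum_voronoiWeight hΩc hs (fun z => ⟨(hsΩ z).1, (hsΩ z).2.1⟩)
        (fun ω => ‖fhat f ω‖ₑ ^ 2) _)
    nlinarith [le_abs_self (κ (1 / 4)), abs_nonneg (κ (1 / 4))]
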